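/- Let $X$ be a projective toric variety over $\overline{\mathbb{Q}}$: a projective variety (integral, separated scheme of finite type) with an open embedding of an algebraic torus $T\cong\mathbb{G}_m^n$, $n\ge 0$, such that the action of $T$ on itself by multiplication extends to an action of $T$ on $X$. Suppose that $X$ is $\mathbb{Q}$-factorial, that is, $X$ is normal and every Weil divisor on $X$ has a positive integer multiple that is Cartier. Let $f\colon X\to X$ be a surjective toric morphism, that is, a surjective morphism over $\overline{\mathbb{Q}}$ with $f(T)\subseteq T$ such that $f|_T\colon T\to T$ is a homomorphism of algebraic groups. Then the set of pre-periodic points of $f$, that is, of the points $x\in X(\overline{\mathbb{Q}})$ such that $f^{a+b}(x)=f^{a}(x)$ for some integers $a\ge 0$ and $b\ge 1$, is Zariski dense in $X$. -/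

import Mathlib

open AlgebraicGeometry CategoryTheory MonoidalCategory

noncomputable section

universe u

/-- The coordinate ring `K[ℤⁿ] = K[t₁^{±1}, …, tₙ^{±1}]` of the split torus of dimension `n`. -/
abbrev torusRing (K : Type u) [Field K] (n : ℕ) : Type u :=
  AddMonoidAlgebra K (Fin n → ℤ)

/-- The split torus `𝔾ₘⁿ = Spec K[ℤⁿ]` over `K`. Its group structure is the one coming from the
Hopf algebra structure of the group algebra (in which every character `χ` is group-like). -/
abbrev torus (K : Type u) [Field K] (n : ℕ) : Over (Spec (.of K)) :=
  (Spec (.of (torusRing K n))).asOver (Spec (.of K))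

/-- A variety over `K`: an integral scheme, separated and of finite type over `K`. -/
class IsVarietyOver {K : Type u} [Field K] (X : Over (Spec (.of K))) : Prop where
  isIntegral : IsIntegral X.left
  isSeparated : IsSeparated X.hom
  locallyOfFiniteType : LocallyOfFiniteType X.hom
  quasiCompact : QuasiCompact X.hom

attribute [instance] IsVarietyOver.isIntegral IsVarietyOver.isSeparated
  IsVarietyOver.locallyOfFiniteType IsVarietyOver.quasiCompact

instance IsVarietyOver.isLocallyNoetherian {K : Type u} [Field K] (X : Over (Spec (.of K)))
    [IsVarietyOver X] : IsLocallyNoetherian X.left :=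
  LocallyOfFiniteType.isLocallyNoetherian X.hom

/-- A toric variety over `K`: a variety `X` with an open embedding of a split torus `T` such that
the action of `T` on itself by multiplication extends to an action of `T` on `X`. -/
structure ToricVariety (K : Type u) [Field K] where
  /-- the underlying scheme over `K` -/
  X : Over (Spec (.of K))
  isVarietyOver : IsVarietyOver X
  /-- the dimension of the torus -/
  dim : ℕ
  /-- the embedding of the torus -/
  incl : torus K dim ⟶ X
  isOpenImmersion : IsOpenImmersion incl.left
  /-- the action of the torus on `X` -/
  act : ModObj (torus K dim) X
  act_incl : (torus K dim ◁ incl) ≫ (act.smul : torus K dim ⊗ X ⟶ X) =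
    (MonObj.mul : torus K dim ⊗ torus K dim ⟶ torus K dim) ≫ incl

attribute [instance] ToricVariety.isVarietyOver ToricVariety.isOpenImmersion

/-- A morphism `f : X ⟶ Y` of toric varieties is toric if it maps the torus of `X` into the torus
of `Y` and restricts to a homomorphism of algebraic groups between these tori. -/
def IsToricMorphism {K : Type u} [Field K] (X Y : ToricVariety K) (f : X.X ⟶ Y.X) : Prop :=
  ∃ φ : torus K X.dim ⟶ torus K Y.dim, IsMonHom φ ∧ X.incl ≫ f = φ ≫ Y.incl

/-- Projective space `ℙᵐ = Proj K[x₀, …, xₘ]` over `K`. -/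
def projectiveSpace (K : Type u) [Field K] (m : ℕ) : Over (Spec (.of K)) :=
  letI := MvPolynomial.gradedAlgebra (σ := Fin (m + 1)) (R := K)
  Over.mk (Y := Proj (MvPolynomial.homogeneousSubmodule (Fin (m + 1)) K))
    (Proj.toSpecZero _ ≫ Spec.map (CommRingCat.ofHom (algebraMap K
      (MvPolynomial.homogeneousSubmodule (Fin (m + 1)) K 0))))

/-- `X` is projective over `K`: it has a closed embedding over `K` into some projective space. -/
def IsProjectiveOver {K : Type u} [Field K] (X : Over (Spec (.of K))) : Prop :=
  ∃ (m : ℕ) (i : X ⟶ projectiveSpace K m), IsClosedImmersion i.left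

/-- A scheme is normal if all its local rings are integrally closed domains. -/
def IsNormalScheme (X : Scheme.{u}) : Prop :=
  ∀ x : X, IsDomain (X.presheaf.stalk x) ∧ IsIntegrallyClosed (X.presheaf.stalk x)

/-- A cycle is a Weil divisor if it is supported in codimension one. (A cycle is a locally finite
integral combination of points; the point `z` stands for the integral closed subscheme with generic
point `z`, of codimension `Order.coheight z`.) -/
def IsWeilDivisor {X : Scheme.{u}} (D : AlgebraicCycle X ℤ) : Prop :=
  ∀ z : X, D z ≠ 0 → Order.coheight z = 1

/-- A Weil divisor is Cartier if locally it is the divisor of a nonzero rational function. -/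
def IsCartierDivisor {X : Scheme.{u}} [IsIntegral X] [IsLocallyNoetherian X]
    (D : AlgebraicCycle X ℤ) : Prop :=
  ∀ x : X, ∃ U : X.Opens, x ∈ U ∧ ∃ g : X.functionField, g ≠ 0 ∧
    ∀ z ∈ U, D z = Scheme.ord g z

/-- `X` is `ℚ`-factorial if it is normal and every Weil divisor on `X` has a positive integer
multiple that is Cartier. -/
def IsQFactorial (X : Scheme.{u}) [IsIntegral X] [IsLocallyNoetherian X] : Prop :=
  IsNormalScheme X ∧ ∀ D : AlgebraicCycle X ℤ, IsWeilDivisor D →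
    ∃ m : ℕ, 0 < m ∧ IsCartierDivisor (m • D)

/-- A `K`-point `x` of `X` is pre-periodic for `f : X ⟶ X` if `f^{a+b}(x) = f^a(x)` for some
`a ≥ 0` and `b ≥ 1`. -/
def IsPreperiodicPoint {K : Type u} [Field K] {X : Over (Spec (.of K))} (f : X ⟶ X)
    (x : Over.mk (𝟙 (Spec (.of K))) ⟶ X) : Prop :=
  ∃ a b : ℕ, 0 < b ∧ x ≫ End.of f ^ (a + b) = x ≫ End.of f ^ a

/-- The set of points of the scheme `X` underlying the pre-periodic `K`-points of `f`. -/
def preperiodicPoints {K : Type u} [Field K] {X : Over (Spec (.of K))} (f : X ⟶ X) :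
    Set X.left :=
  {p | ∃ x : Over.mk (𝟙 (Spec (.of K))) ⟶ X,
    IsPreperiodicPoint f x ∧ x.left (IsLocalRing.closedPoint K) = p}

end

/-!
A toric morphism restricts to a homomorphism `φ` of the torus `T`, which maps the group of
`N`-torsion points of `T` to itself. This group is finite, so every torsion point of `T` is
pre-periodic for `φ`, hence for `f` (`IsPreperiodicPoint.of_isOfFinOrder`,
`IsPreperiodicPoint.comp`). Moreover the torsion points are dense in `T`, which is open and nonempty
in the irreducible scheme `X`, hence dense in it.

For the density of torsion points (`dense_torsionPoints`), a `K`-point of `T` is a homomorphism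
`χ : ℤⁿ → Kˣ`, and a Laurent polynomial `∑ aᵥ tᵛ` takes the value `∑ aᵥ χ(v)` at it. The evaluations
`χ ↦ χ(v)` are pairwise distinct characters of the group of torsion points, because `K` has roots of
unity of arbitrarily large order. By Dedekind's theorem they are linearly independent, so a Laurent
polynomial that vanishes at all torsion points is zero.
-/

section TorsionCharacters

variable {K : Type u} [Field K] {n : ℕ}

/-- A homomorphism out of `ℤⁿ` is determined by its values on the standard basis, and there are only
finitely many `N`-th roots of unity. -/
theorem finite_setOf_monoidHom_pow_eq_one {N : ℕ} (hN : 0 < N) :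
    {χ : Multiplicative (Fin n → ℤ) →* K | χ ^ N = 1}.Finite := by
  have hroots : {z : K | z ^ N = 1}.Finite := by
    refine ((Polynomial.nthRootsFinset N (1 : K)).finite_toSet).subset fun z hz ↦ ?_
    exact (Polynomial.mem_nthRootsFinset hN 1).2 hz
  refine Set.Finite.of_finite_image
    (f := fun χ i ↦ χ (Multiplicative.ofAdd (Pi.single i 1)))
    ((Set.Finite.pi' fun _ : Fin n ↦ hroots).subset ?_) ?_
  · rintro _ ⟨χ, hχ, rfl⟩ i
    have := DFunLike.congr_fun hχ (Multiplicative.ofAdd (Pi.single i 1))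
    simpa using this
  · intro χ _ ψ _ h
    apply MonoidHom.toAdditiveRight.injective
    refine AddMonoidHom.functions_ext' _ _ _ fun i ↦ AddMonoidHom.ext_int ?_
    exact congrFun h i

theorem exists_torsion_apply_ne_one [IsAlgClosed K] [CharZero K] {v : Fin n → ℤ} (hv : v ≠ 0) :
    ∃ χ : Multiplicative (Fin n → ℤ) →* K, IsOfFinOrder χ ∧ χ (Multiplicative.ofAdd v) ≠ 1 := by
  obtain ⟨i, hi⟩ := Function.ne_iff.1 hv
  have : NeZero (((v i).natAbs + 1 : ℕ) : K) := ⟨Nat.cast_ne_zero.2 (Nat.succ_ne_zero _)⟩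
  -- The order `|vᵢ| + 1` does not divide `vᵢ ≠ 0`, so `w ↦ ζ ^ wᵢ` separates `v` from `0`.
  obtain ⟨ζ, hζ⟩ := HasEnoughRootsOfUnity.exists_primitiveRoot K ((v i).natAbs + 1)
  lift ζ to Kˣ using hζ.isUnit (Nat.succ_ne_zero _)
  rw [IsPrimitiveRoot.coe_units_iff] at hζ
  refine ⟨(Units.coeHom K).comp ((zpowersHom Kˣ ζ).comp
    (AddMonoidHom.toMultiplicative (Pi.evalAddMonoidHom (fun _ : Fin n ↦ ℤ) i))),
    isOfFinOrder_iff_pow_eq_one.2 ⟨(v i).natAbs + 1, Nat.succ_pos _, ?_⟩, ?_⟩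
  · refine MonoidHom.ext fun w ↦ ?_
    have : (ζ ^ (w.toAdd i)) ^ ((v i).natAbs + 1) = 1 := by
      rw [← zpow_natCast, zpow_comm, zpow_natCast, hζ.pow_eq_one, one_zpow]
    have h' := congrArg Units.val this
    simpa [Units.val_pow_eq_pow_val, Units.val_zpow_eq_zpow_val] using h'
  · intro h
    have h' : ζ ^ (v i) = 1 := by
      apply Units.ext
      simpa using h
    have hdvd := Int.natAbs_dvd_natAbs.2 ((hζ.zpow_eq_one_iff_dvd _).1 h')
    exact hi (Int.natAbs_eq_zero.1 (Nat.eq_zero_of_dvd_of_lt hdvd (by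
      rw [Int.natAbs_natCast]; exact Nat.lt_succ_self _)))

/-- Distinct `v : ℤⁿ` give distinct characters `χ ↦ χ v` of the group of torsion homomorphisms, so
Dedekind's linear independence of characters makes the coefficients of `h` vanish. -/
theorem eq_zero_of_forall_torsion_lift_eq_zero [IsAlgClosed K] [CharZero K] (h : torusRing K n)
    (H : ∀ χ : Multiplicative (Fin n → ℤ) →* K, IsOfFinOrder χ →
      AddMonoidAlgebra.lift K K (Fin n → ℤ) χ h = 0) : h = 0 := by
  let T := CommMonoid.torsion (Multiplicative (Fin n → ℤ) →* K)
  let ev (v : Fin n → ℤ) : T →* K :=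
    (MonoidHom.eval (Multiplicative.ofAdd v)).comp T.subtype
  have hev : Function.Injective ev := by
    intro v w hvw
    by_contra hne
    obtain ⟨χ, hχ, hχv⟩ := exists_torsion_apply_ne_one (K := K) (sub_ne_zero.2 hne)
    apply hχv
    have h1 : χ (Multiplicative.ofAdd v) = χ (Multiplicative.ofAdd w) :=
      DFunLike.congr_fun hvw ⟨χ, hχ⟩
    have h2 : χ (Multiplicative.ofAdd (v - w)) * χ (Multiplicative.ofAdd w) =
        χ (Multiplicative.ofAdd w) := by
      rw [← map_mul, ← ofAdd_add, sub_add_cancel, h1]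
    have h3 : χ (Multiplicative.ofAdd w) ≠ 0 :=
      ((Group.isUnit (Multiplicative.ofAdd w)).map χ).ne_zero
    exact mul_eq_right₀ h3 |>.1 h2
  have hli := (linearIndependent_monoidHom T K).comp ev hev
  have := linearIndependent_iff.1 hli h.coeff (by
    ext χ
    have := H χ.1 χ.2
    rw [AddMonoidAlgebra.lift_apply] at this
    simpa [Finsupp.linearCombination_apply, Finsupp.sum, ev] using this)
  exact AddMonoidAlgebra.coeff_injective this

end TorsionCharacters

section TorusPoints

open MonObj

variable (K : Type u) [Field K] (n : ℕ)

/-- The terminal object `Spec K` of schemes over `Spec K`, whose structure morphism is the identity,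
is isomorphic to `Spec K` with the structure morphism induced by the `K`-algebra `K`. -/
noncomputable def specSelfIso : Over.mk (𝟙 (Spec (.of K))) ≅
    @Scheme.asOver (Spec (.of K)) (Spec (.of K)) specOverSpec :=
  Over.isoMk (Iso.refl _) (by simp [specOverSpec_over]; exact Category.comp_id _)

/-- The group of `K`-points of the torus with character lattice `ℤⁿ` is the group of homomorphisms
`ℤⁿ → Kˣ`, here encoded as monoid homomorphisms into `K`. -/
noncomputable def torusPointEquiv : (Multiplicative (Fin n → ℤ) →* K) ≃*
    (Over.mk (𝟙 (Spec (.of K))) ⟶ torus K n) :=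
  MulEquiv.trans (AddMonoidAlgebra.liftMulEquiv K K (Fin n → ℤ)) <|
    (Spec.mapMulEquiv (R := K) (S := torusRing K n) (T := K)).trans
  { toFun x := (specSelfIso K).hom ≫ x
    invFun x := (specSelfIso K).inv ≫ x
    left_inv x := by simp
    right_inv x := by simp
    map_mul' x y := MonObj.comp_mul _ _ _ }

theorem torusPointEquiv_left (χ : Multiplicative (Fin n → ℤ) →* K) :
    (torusPointEquiv K n χ).left =
      Spec.map (CommRingCat.ofHom (AddMonoidAlgebra.lift K K (Fin n → ℤ) χ).toRingHom) :=
  Category.id_comp _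

variable {K n}

/-- A homomorphism of the torus preserves the finite group of points killed by `N`, so the orbit
of such a point meets itself. -/
theorem IsPreperiodicPoint.of_isOfFinOrder {x : Over.mk (𝟙 (Spec (.of K))) ⟶ torus K n}
    (hx : IsOfFinOrder x) (φ : torus K n ⟶ torus K n) [IsMonHom φ] : IsPreperiodicPoint φ x := by
  obtain ⟨N, hN, hxN⟩ := isOfFinOrder_iff_pow_eq_one.1 hx
  have hfin : {y : Over.mk (𝟙 (Spec (.of K))) ⟶ torus K n | y ^ N = 1}.Finite := by
    refine ((finite_setOf_monoidHom_pow_eq_one (K := K) (n := n) hN).image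
      (torusPointEquiv K n)).subset fun y hy ↦ ?_
    refine ⟨(torusPointEquiv K n).symm y, ?_, by simp⟩
    rw [Set.mem_ofPred_eq, ← map_pow, hy, map_one]
  have hmem (k : ℕ) : (x ≫ End.of φ ^ k) ^ N = 1 := by
    induction k with
    | zero => simpa [End.one_def] using hxN
    | succ k ih =>
      have : x ≫ End.of φ ^ (k + 1) = (x ≫ End.of φ ^ k) ≫ φ := by
        rw [pow_succ', End.mul_def, Category.assoc]
      rw [this, ← MonObj.pow_comp, ih, MonObj.one_comp]
  obtain ⟨i, -, j, -, hij, h⟩ := Set.infinite_univ.exists_lt_map_eq_of_mapsTo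
    (f := fun k : ℕ ↦ x ≫ End.of φ ^ k) (fun k _ ↦ hmem k) hfin
  exact ⟨i, j - i, by omega, by rw [Nat.add_sub_cancel' hij.le]; exact h.symm⟩

theorem dense_torsionPoints [IsAlgClosed K] [CharZero K] :
    Dense {p : (torus K n).left | ∃ x : Over.mk (𝟙 (Spec (.of K))) ⟶ torus K n,
      IsOfFinOrder x ∧ x.left (IsLocalRing.closedPoint K) = p} := by
  refine (PrimeSpectrum.isTopologicalBasis_basic_opens).dense_iff.2 ?_
  rintro _ ⟨h, rfl⟩ hne
  have h0 : h ≠ 0 := by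
    rintro rfl
    simp at hne
  obtain ⟨χ, hχ, hχh⟩ : ∃ χ : Multiplicative (Fin n → ℤ) →* K, IsOfFinOrder χ ∧
      AddMonoidAlgebra.lift K K (Fin n → ℤ) χ h ≠ 0 := by
    by_contra! H
    exact h0 (eq_zero_of_forall_torsion_lift_eq_zero h H)
  refine ⟨_, ?_, torusPointEquiv K n χ, (torusPointEquiv K n).toMonoidHom.isOfFinOrder hχ, rfl⟩
  rw [torusPointEquiv_left]
  -- The closed point of `Spec K` goes to the kernel of evaluation at `χ`.
  change AddMonoidAlgebra.lift K K (Fin n → ℤ) χ h ∉ IsLocalRing.maximalIdeal K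
  rw [IsLocalRing.maximalIdeal_eq_bot]
  simpa using hχh

theorem IsPreperiodicPoint.comp {K : Type u} [Field K] {X Y : Over (Spec (.of K))}
    {f : X ⟶ X} {g : Y ⟶ Y} {i : X ⟶ Y} (h : i ≫ g = f ≫ i)
    {x : Over.mk (𝟙 (Spec (.of K))) ⟶ X} (hx : IsPreperiodicPoint f x) :
    IsPreperiodicPoint g (x ≫ i) := by
  obtain ⟨a, b, hb, hab⟩ := hx
  have key (k : ℕ) : i ≫ End.of g ^ k = (End.of f ^ k) ≫ i := by
    induction k with
    | zero => simp [End.one_def]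
    | succ k ih =>
      rw [pow_succ', pow_succ', End.mul_def, End.mul_def, reassoc_of% ih, Category.assoc]
      exact congrArg ((End.of f ^ k) ≫ ·) h
  exact ⟨a, b, hb, by
    rw [Category.assoc, Category.assoc, key, key, reassoc_of% hab]⟩

end TorusPoints

theorem mainTheorem5 (X : ToricVariety (AlgebraicClosure ℚ))
    (hproj : IsProjectiveOver X.X) (hfact : IsQFactorial X.X.left)
    (f : X.X ⟶ X.X) (hf : IsToricMorphism X X f) (hsurj : Surjective f.left) :
    Dense (preperiodicPoints f) := by
  obtain ⟨φ, hφ, h⟩ := hf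
  have : Nonempty (torus (AlgebraicClosure ℚ) X.dim).left :=
    inferInstanceAs (Nonempty (PrimeSpectrum (torusRing (AlgebraicClosure ℚ) X.dim)))
  have hr : DenseRange X.incl.left :=
    X.incl.left.isOpenEmbedding.isOpen_range.dense (Set.range_nonempty _)
  refine (hr.dense_image X.incl.left.continuous dense_torsionPoints).mono ?_
  rintro _ ⟨_, ⟨x, hx, rfl⟩, rfl⟩
  exact ⟨x ≫ X.incl, (IsPreperiodicPoint.of_isOfFinOrder hx φ).comp h, rfl⟩
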